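/- Let $T>0$, $0<\beta<\tfrac12$ and $1\le q<\frac{1}{1-2\beta}$. There is a constant $C$, depending only on $T,\beta,q$, such that the following holds for every $\psi\in C^\beta([0,T])$ with $\psi(0)=0$. Consider the problem $$\partial_t u=\partial_x^2u \ \text{ on } (0,T)\times(0,\infty),\qquad u(0,x)=0\ \ (x>0),\qquad u(t,0)=\psi(t)\ \ (0\le t\le T).$$ By a bounded classical solution we mean a bounded function $u$, continuous on $[0,T]\times(0,\infty)$, differentiable in $t$ and twice continuously differentiable in $x$ on $(0,T)\times(0,\infty)$, that satisfies the equation and the initial condition pointwise and the boundary condition in the sense that $u(s,x)\to\psi(t)$ as $(s,x)\to(t,0)$ with $s\in[0,T]$, $x>0$, for every $t\in[0,T]$. Then $$u(t,x)=-2\int_0^t\partial_xG(t-\tau,x)\,\psi(\tau)\,d\tau,\qquad G(t,x)=\frac{1}{\sqrt{4\pi t}}\,e^{-x^2/(4t)},$$ is a bounded classical solution, and every bounded classical solution $u$ satisfies $$\sup_{t\in[0,T]}\|u(t,\cdot)\|_{W^{1,q}(\mathbb R_+)}\le C\,\|\psi\|_{C^\beta([0,T])}.$$ Here $\|f\|_{W^{1,q}(\mathbb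 R_+)}=\bigl(\|f\|_{L^q(0,\infty)}^q+\|f'\|_{L^q(0,\infty)}^q\bigr)^{1/q}$ with $f'$ the weak derivative of $f$ on $(0,\infty)$ (and $\|f\|_{W^{1,q}(\mathbb R_+)}=\infty$ if $f\notin W^{1,q}(\mathbb R_+)$), and $\|\psi\|_{C^\beta([0,T])}=\sup_{[0,T]}|\psi|+\sup_{s\ne t}\frac{|\psi(t)-\psi(s)|}{|t-s|^\beta}$. -/

import Mathlib

open Set Filter Topology MeasureTheory
open scoped NNReal ENNReal ContDiff

noncomputable section

/-- The heat kernel `G(t,x) = (4πt)^{-1/2} exp(-x²/(4t))` on the real line. -/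
def heatKernel (t x : ℝ) : ℝ :=
  1 / Real.sqrt (4 * Real.pi * t) * Real.exp (-x ^ 2 / (4 * t))

/-- The explicit solution `u(t,x) = -2 ∫₀ᵗ ∂ₓG(t-τ,x) ψ(τ) dτ`, for `t ≥ 0` and `x > 0`, of the heat
equation on the half-line with zero initial datum and Dirichlet boundary datum `ψ`. -/
def dirichletHeat (ψ : ℝ → ℝ) (t x : ℝ) : ℝ :=
  -2 * ∫ τ in (0 : ℝ)..t, deriv (fun y => heatKernel (t - τ) y) x * ψ τ

/-- `u` is a bounded classical solution, on `[0,T] × (0,∞)`, of `∂ₜu = ∂ₓ²u`, `u(0,·) = 0`,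
`u(·,0) = ψ`. Only the values of `u` on `[0,T] × (0,∞)` and of `ψ` on `[0,T]` matter. -/
structure IsHeatSolution (T : ℝ) (ψ : ℝ → ℝ) (u : ℝ → ℝ → ℝ) : Prop where
  /-- `u` is bounded. -/
  bounded : ∃ M : ℝ, ∀ t ∈ Icc 0 T, ∀ x ∈ Ioi (0 : ℝ), |u t x| ≤ M
  /-- `u` is continuous in the pair `(t,x)`, up to the times `0` and `T`. -/
  continuousOn : ContinuousOn (fun z : ℝ × ℝ => u z.1 z.2) (Icc 0 T ×ˢ Ioi 0)
  /-- `u` is differentiable in time. -/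
  time_diff : ∀ t ∈ Ioo 0 T, ∀ x ∈ Ioi (0 : ℝ), DifferentiableAt ℝ (fun τ => u τ x) t
  /-- `u` is twice continuously differentiable in space. -/
  space_diff : ∀ t ∈ Ioo 0 T, ∀ x ∈ Ioi (0 : ℝ), ContDiffAt ℝ 2 (u t) x
  /-- The heat equation. -/
  heat_eq : ∀ t ∈ Ioo 0 T, ∀ x ∈ Ioi (0 : ℝ), deriv (fun τ => u τ x) t = iteratedDeriv 2 (u t) x
  /-- The initial condition. -/
  initial : ∀ x ∈ Ioi (0 : ℝ), u 0 x = 0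
  /-- The boundary condition: `u(s,x) → ψ(t)` as `(s,x) → (t,0)` within `[0,T] × (0,∞)`. -/
  boundary : ∀ t ∈ Icc 0 T,
    Tendsto (fun z : ℝ × ℝ => u z.1 z.2) (𝓝[Icc 0 T ×ˢ Ioi 0] (t, 0)) (𝓝 (ψ t))

/-- `g` is a weak (distributional) derivative of `f` on the half-line `(0,∞)`. -/
def IsWeakDerivHalfLine (f g : ℝ → ℝ) : Prop :=
  LocallyIntegrableOn f (Ioi 0) ∧ LocallyIntegrableOn g (Ioi 0) ∧
    ∀ φ : ℝ → ℝ, ContDiff ℝ ∞ φ → HasCompactSupport φ → tsupport φ ⊆ Ioi 0 →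
      ∫ x in Ioi 0, f x * deriv φ x = -∫ x in Ioi 0, g x * φ x

/-- The norm of `W^{1,q}(0,∞)`, `(‖f‖_{L^q}^q + ‖f'‖_{L^q}^q)^{1/q}` with `f'` the weak derivative
(which is unique up to null sets, so that the infimum is over a single value), as an element of
`[0,∞]`. It is `∞` when `f` is not in `W^{1,q}(0,∞)`, in particular when `f` has no weak
derivative. -/
def eSobolevNorm (q : ℝ) (f : ℝ → ℝ) : ℝ≥0∞ :=
  ⨅ (g : ℝ → ℝ) (_ : IsWeakDerivHalfLine f g),
    (eLpNorm f (ENNReal.ofReal q) (volume.restrict (Ioi 0)) ^ q +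
      eLpNorm g (ENNReal.ofReal q) (volume.restrict (Ioi 0)) ^ q) ^ (1 / q)

/-- The norm of `C^β([0,T])`: the supremum norm plus the Hölder seminorm, as an element of
`[0,∞]`. -/
def eHolderNormOn (T : ℝ) (β : ℝ≥0) (ψ : ℝ → ℝ) : ℝ≥0∞ :=
  (⨆ t ∈ Icc 0 T, ‖ψ t‖ₑ) + eHolderNorm β ((Icc 0 T).domRestrict ψ)

end

/-!
With `c = (4π)^{-1/2}` and the profiles `Φₙ(r,x) = r^{-n/2} exp(-x²/(4r))`, extended by zero to
`r ≤ 0` (`profile`), the heat kernel is `G = c Φ₁` and the kernel of the explicit solution is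
`-2 ∂ₓG = c x Φ₃`. The profiles are closed under differentiation in both variables, also across
`r = 0` as long as `x > 0`, and they are bounded in `r` by a multiple of `x⁻ⁿ`.

*Existence.* Extend the datum `ψ` to a bounded continuous `Ψ` on the line by its end values, so that
`Ψ = 0` before time zero. The solution is `c x ∫ Φ₃(t-τ,x) Ψ(τ) dτ` over the fixed interval `(0,T]`,
which may be differentiated under the integral sign any number of times; this gives smoothness and
the equation. The substitution `t - τ = x² ρ` turns it into an average
`∫ c Φ₃(ρ,1) Ψ(t - x²ρ) dρ` against a probability density (`average`), from which boundedness,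
continuity and the boundary condition follow by dominated convergence.

*Uniqueness.* A bounded solution `w` with zero data satisfies `w ≤ ε (x² + 3t)` for every `ε > 0`
(`le_barrier`), by the maximum principle on `[0,S] × [0,R]` with `S < T` and `R` large.

*Estimate.* The substitution gives
`∂ₓu(t,x) = x⁻¹ ∫ c (Φ₃ - Φ₅/2)(ρ,1) (Ψ(t - x²ρ) - Ψ(t)) dρ`, where `Ψ(t)` may be subtracted because
`Φ₃ - Φ₅/2 = -2 ∂_ρ Φ₁` at `x = 1` has integral zero. Hence `|∂ₓu| ≤ C ‖ψ‖ x^{2β-1}`, the moment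
`∫ ρ^{β-3/2} dρ` at infinity being finite as `β < 1/2`. This is in `L^q` near `0` exactly when
`q < 1/(1-2β)`. For large `x` the pointwise bounds on the profiles give `|u| + |∂ₓu| ≤ C ‖ψ‖ x⁻²`.
-/

namespace HalfLineHeat

/-! ### Profiles of the heat kernel -/

/-- The profile `r^{-n/2} exp(-x²/(4r))`. Since `√r = 0` for `r ≤ 0`, it vanishes there as soon as
`n ≠ 0`, so it is automatically extended by zero to nonpositive times. -/
noncomputable def profile (n : ℕ) (r x : ℝ) : ℝ :=
  (√r)⁻¹ ^ n * Real.exp (-x ^ 2 / (4 * r))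

lemma profile_nonneg (n : ℕ) (r x : ℝ) : 0 ≤ profile n r x := by
  unfold profile; positivity

lemma profile_of_nonpos {n : ℕ} (hn : n ≠ 0) {r : ℝ} (hr : r ≤ 0) (x : ℝ) :
    profile n r x = 0 := by
  simp [profile, Real.sqrt_eq_zero_of_nonpos hr, hn]

@[fun_prop]
lemma measurable_profile (n : ℕ) (x : ℝ) : Measurable fun r => profile n r x := by
  unfold profile; fun_prop

lemma inv_sqrt_sq {r : ℝ} (hr : 0 ≤ r) : (√r)⁻¹ ^ 2 = r⁻¹ := by
  rw [inv_pow, Real.sq_sqrt hr]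

/-- The profiles are bounded uniformly in time away from `x = 0`: with `s = r^{-1/2}`, this is
`sⁿ ≤ n! x⁻ⁿ e^{xs}` together with `xs - x²s²/4 ≤ 1`. -/
lemma profile_le {n : ℕ} (hn : n ≠ 0) (r : ℝ) {x : ℝ} (hx : 0 < x) :
    profile n r x ≤ Real.exp 1 * n.factorial / x ^ n := by
  rcases le_or_gt r 0 with hr | hr
  · rw [profile_of_nonpos hn hr]; positivity
  have hs : 0 < (√r)⁻¹ := inv_pos.2 (Real.sqrt_pos.2 hr)
  have e : -x ^ 2 / (4 * r) = -(x * (√r)⁻¹) ^ 2 / 4 := by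
    rw [mul_pow, inv_sqrt_sq hr.le]; field_simp
  unfold profile
  rw [e]
  set s := (√r)⁻¹
  have h1 := Real.pow_div_factorial_le_exp (x * s) (by positivity) n
  have h2 : Real.exp (x * s) * Real.exp (-(x * s) ^ 2 / 4) ≤ Real.exp 1 := by
    rw [← Real.exp_add]
    exact Real.exp_le_exp.2 (by nlinarith [sq_nonneg (x * s - 2)])
  rw [le_div_iff₀ (by positivity)]
  rw [div_le_iff₀ (by positivity)] at h1
  calc s ^ n * Real.exp (-(x * s) ^ 2 / 4) * x ^ n
      = (x * s) ^ n * Real.exp (-(x * s) ^ 2 / 4) := by ring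
    _ ≤ (Real.exp (x * s) * n.factorial) * Real.exp (-(x * s) ^ 2 / 4) := by gcongr
    _ = (Real.exp (x * s) * Real.exp (-(x * s) ^ 2 / 4)) * n.factorial := by ring
    _ ≤ Real.exp 1 * n.factorial := by gcongr

lemma hasDerivAt_profile_space {n : ℕ} (hn : n ≠ 0) (r x : ℝ) :
    HasDerivAt (fun y => profile n r y) (-(x / 2) * profile (n + 2) r x) x := by
  rcases le_or_gt r 0 with hr | hr
  · simp only [profile_of_nonpos hn hr, profile_of_nonpos (show n + 2 ≠ 0 by omega) hr, mul_zero]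
    exact hasDerivAt_const _ _
  · have h := (((((hasDerivAt_id x).pow 2).neg).div_const (4 * r)).exp).const_mul ((√r)⁻¹ ^ n)
    refine h.congr_deriv ?_
    simp only [profile, pow_add _ n 2, inv_sqrt_sq hr.le, id, Pi.neg_apply, Pi.pow_apply]
    field_simp
    norm_num
    ring

/-- The profiles are differentiable in time across `r = 0`, because they vanish there to second
order. -/
lemma hasDerivAt_profile_time {n : ℕ} (hn : n ≠ 0) (r : ℝ) {x : ℝ} (hx : 0 < x) :
    HasDerivAt (fun s => profile n s x)
      (-(n / 2) * profile (n + 2) r x + x ^ 2 / 4 * profile (n + 4) r x) r := by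
  rcases lt_trichotomy r 0 with hr | rfl | hr
  · rw [profile_of_nonpos (by omega) hr.le, profile_of_nonpos (by omega) hr.le]
    simp only [mul_zero, add_zero]
    refine (hasDerivAt_const r (0 : ℝ)).congr_of_eventuallyEq ?_
    filter_upwards [gt_mem_nhds hr] with s hs using profile_of_nonpos hn hs.le x
  · rw [profile_of_nonpos (by omega) le_rfl, profile_of_nonpos (by omega) le_rfl]
    simp only [mul_zero, add_zero]
    have h : (fun s => profile n s x) =O[𝓝 0] fun s : ℝ => ‖s - 0‖ ^ 2 := by
      refine Asymptotics.IsBigO.of_bound (Real.exp 1 * (n + 4).factorial / x ^ (n + 4))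
        (Eventually.of_forall fun s => ?_)
      rcases le_or_gt s 0 with hs | hs
      · rw [profile_of_nonpos hn hs]; simp only [norm_zero]; positivity
      · have e : profile n s x = profile (n + 4) s x * s ^ 2 := by
          unfold profile
          rw [pow_add _ n 4, show 4 = 2 * 2 from rfl, pow_mul, inv_sqrt_sq hs.le]
          field_simp
        rw [Real.norm_of_nonneg (profile_nonneg _ _ _), sub_zero,
          Real.norm_of_nonneg (by positivity), Real.norm_of_nonneg hs.le, e]
        gcongr
        exact profile_le (by omega) s hx
    exact (h.hasFDerivAt one_lt_two).hasDerivAt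
  · have hs : √r ≠ 0 := (Real.sqrt_pos.2 hr).ne'
    have h1 := (((Real.hasDerivAt_sqrt hr.ne').inv hs).pow n)
    have h2 := (((hasDerivAt_id r).const_mul (4 : ℝ)).inv (by simp [hr.ne'])).const_mul (-x ^ 2)
    refine (h1.mul h2.exp).congr_deriv ?_
    obtain ⟨m, rfl⟩ := Nat.exists_eq_succ_of_ne_zero hn
    have hq : √r ^ 2 = r := Real.sq_sqrt hr.le
    simp only [profile, id, Pi.inv_apply, Pi.pow_apply, div_eq_mul_inv]
    have e2 : (√r)⁻¹ ^ (m.succ + 2) = (√r)⁻¹ ^ m * (√r)⁻¹ * r⁻¹ := by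
      rw [pow_add, inv_sqrt_sq hr.le, pow_succ]
    have e4 : (√r)⁻¹ ^ (m.succ + 4) = (√r)⁻¹ ^ m * (√r)⁻¹ * r⁻¹ ^ 2 := by
      rw [pow_add, show 4 = 2 * 2 from rfl, pow_mul, inv_sqrt_sq hr.le, pow_succ]
    rw [e2, e4, hq]
    simp only [Nat.succ_eq_add_one, Nat.add_sub_cancel, pow_succ, mul_inv]
    push_cast
    field_simp

/-- Parabolic scaling. -/
lemma profile_scale (n : ℕ) (r : ℝ) {x : ℝ} (hx : 0 < x) :
    profile n (x ^ 2 * r) x = (x ^ n)⁻¹ * profile n r 1 := by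
  unfold profile
  rw [Real.sqrt_mul (by positivity), Real.sqrt_sq hx.le, mul_inv, mul_pow, inv_pow x]
  rw [show -x ^ 2 / (4 * (x ^ 2 * r)) = -1 ^ 2 / (4 * r) by
    rw [show 4 * (x ^ 2 * r) = x ^ 2 * (4 * r) by ring, one_pow, neg_div, neg_div,
      ← div_div, div_self (by positivity)]]
  ring

/-- At unit distance the profile is bounded near time zero, and decays like `ρ^{-n/2}` at infinity;
for `n ≥ 3` this beats a factor `ρ^β` with `β < 1/2`. -/
lemma integrable_profile_mul_rpow {n : ℕ} (hn : 3 ≤ n) {β : ℝ} (hβ0 : 0 ≤ β) (hβ : β < 1 / 2) :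
    Integrable fun ρ => profile n ρ 1 * |ρ| ^ β := by
  have hm : Measurable fun ρ : ℝ => profile n ρ 1 * |ρ| ^ β :=
    (measurable_profile n 1).mul (by fun_prop)
  rw [← integrableOn_univ, ← Iic_union_Ioi (a := (1 : ℝ)), integrableOn_union]
  constructor
  · rw [← Iic_union_Ioc_eq_Iic zero_le_one, integrableOn_union]
    constructor
    · refine integrableOn_zero.congr_fun (fun ρ hρ => ?_) measurableSet_Iic
      simp [profile_of_nonpos (show n ≠ 0 by omega) hρ]
    · refine Measure.integrableOn_of_bounded (M := Real.exp 1 * n.factorial / 1 ^ n) (by simp)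
        hm.aestronglyMeasurable ?_
      filter_upwards [ae_restrict_mem measurableSet_Ioc] with ρ hρ
      rw [Real.norm_of_nonneg (mul_nonneg (profile_nonneg _ _ _) (by positivity))]
      refine (mul_le_of_le_one_right (profile_nonneg _ _ _) ?_).trans
        (profile_le (by omega) ρ one_pos)
      exact Real.rpow_le_one (abs_nonneg _) (by rw [abs_of_pos hρ.1]; exact hρ.2) hβ0
  · refine Integrable.mono' (integrableOn_Ioi_rpow_of_lt (a := -(3 / 2) + β) (by linarith) one_pos)
      hm.aestronglyMeasurable ?_
    filter_upwards [ae_restrict_mem measurableSet_Ioi] with ρ hρ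
    have hρ1 : 1 < ρ := hρ
    have hρ0 : 0 < ρ := by linarith
    rw [Real.norm_of_nonneg (mul_nonneg (profile_nonneg _ _ _) (by positivity)),
      Real.rpow_add hρ0, abs_of_pos hρ0]
    gcongr
    have h1 : (√ρ)⁻¹ ≤ 1 := inv_le_one_of_one_le₀ (Real.one_le_sqrt.2 hρ1.le)
    calc profile n ρ 1 ≤ (√ρ)⁻¹ ^ n := by
          refine mul_le_of_le_one_right (by positivity) (Real.exp_le_one_iff.2 ?_)
          rw [neg_div]
          have : 0 ≤ (1 : ℝ) ^ 2 / (4 * ρ) := by positivity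
          linarith
      _ ≤ (√ρ)⁻¹ ^ 3 := pow_le_pow_of_le_one (by positivity) h1 hn
      _ = ρ ^ (-(3 / 2) : ℝ) := by
          rw [Real.rpow_neg hρ0.le, inv_pow, Real.sqrt_eq_rpow, ← Real.rpow_natCast,
            ← Real.rpow_mul hρ0.le]
          norm_num

lemma integrable_profile {n : ℕ} (hn : 3 ≤ n) : Integrable fun ρ => profile n ρ 1 := by
  simpa using integrable_profile_mul_rpow hn le_rfl (by norm_num)

/-- The normalization `∫ -2 ∂ₓG(ρ,1) dρ = 1`: under `s = ρ^{-1/2}` the integral becomes a Gaussian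
one. -/
lemma integral_profile_three : ∫ ρ, profile 3 ρ 1 = √(4 * Real.pi) := by
  have h0 : ∫ ρ, profile 3 ρ 1 = ∫ ρ in Ioi 0, profile 3 ρ 1 := by
    symm
    refine setIntegral_eq_integral_of_forall_compl_eq_zero fun ρ hρ => ?_
    exact profile_of_nonpos (by norm_num) (not_lt.1 hρ) 1
  have h := integral_comp_rpow_Ioi (fun s => 2 * Real.exp (-(1 / 4) * s ^ 2))
    (show (-(1 / 2) : ℝ) ≠ 0 by norm_num)
  rw [integral_const_mul, integral_gaussian_Ioi] at h
  rw [h0, ← show 2 * (√(Real.pi / (1 / 4)) / 2) = √(4 * Real.pi) by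
    rw [mul_div_cancel₀ _ two_ne_zero]; congr 1; ring, ← h]
  refine setIntegral_congr_fun measurableSet_Ioi fun ρ hρ => ?_
  have hρ : 0 < ρ := hρ
  have e1 : ρ ^ (-(1 / 2) : ℝ) = (√ρ)⁻¹ := by rw [Real.rpow_neg hρ.le, Real.sqrt_eq_rpow]
  have e2 : ρ ^ (-(1 / 2) - 1 : ℝ) = (√ρ)⁻¹ ^ 3 := by
    rw [← e1, ← Real.rpow_natCast, ← Real.rpow_mul hρ.le]; norm_num
  simp only [profile, e1, e2, inv_sqrt_sq hρ.le, smul_eq_mul]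
  rw [show -1 ^ 2 / (4 * ρ) = -(1 / 4) * ρ⁻¹ by field_simp]
  rw [abs_of_neg (by norm_num)]
  ring

/-- The cancellation `∫ ∂ₓ²G(ρ,1) dρ = 0`: up to a constant factor the integrand is
`∂_ρ G(ρ,1)`, and `G` vanishes at both ends. -/
lemma integral_profile_cancel : ∫ ρ, (profile 3 ρ 1 - 1 / 2 * profile 5 ρ 1) = 0 := by
  have hi : Integrable fun ρ => -2 * (-((1 : ℕ) / 2) * profile 3 ρ 1
      + 1 ^ 2 / 4 * profile 5 ρ 1) :=
    (((integrable_profile le_rfl).const_mul _).add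
      ((integrable_profile (by norm_num)).const_mul _)).const_mul _
  have h := integral_of_hasDerivAt_of_tendsto (f := fun ρ => -2 * profile 1 ρ 1) (m := 0) (n := 0)
    (fun ρ => (hasDerivAt_profile_time one_ne_zero ρ one_pos).const_mul (-2)) hi ?_ ?_
  · rw [sub_zero] at h
    rw [← h]
    refine integral_congr_ae (Eventually.of_forall fun ρ => ?_)
    simp only []
    push_cast
    ring
  · refine (tendsto_congr' ?_).2 tendsto_const_nhds
    filter_upwards [eventually_le_atBot 0] with ρ hρ
    rw [profile_of_nonpos one_ne_zero hρ, mul_zero]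
  · have h1 : Tendsto (fun ρ => profile 1 ρ 1) atTop (𝓝 0) := by
      refine squeeze_zero' (Eventually.of_forall fun ρ => profile_nonneg _ _ _) ?_
        Real.tendsto_sqrt_atTop.inv_tendsto_atTop
      filter_upwards [eventually_ge_atTop 0] with ρ hρ
      simp only [profile, pow_one, Pi.inv_apply]
      refine mul_le_of_le_one_right (by positivity) (Real.exp_le_one_iff.2 ?_)
      rw [neg_div]
      have : 0 ≤ (1 : ℝ) ^ 2 / (4 * ρ) := by positivity
      linarith
    simpa using h1.const_mul (-2)

/-- The kernel of `dirichletHeat` in terms of the profiles, at all times. -/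
lemma deriv_heatKernel (r x : ℝ) :
    deriv (fun y => heatKernel r y) x = -(x / 2) * (√(4 * Real.pi))⁻¹ * profile 3 r x := by
  have e : (fun y => heatKernel r y) = fun y => (√(4 * Real.pi))⁻¹ * profile 1 r y := by
    ext y
    rw [heatKernel, profile, Real.sqrt_mul (by positivity), pow_one, one_div, mul_inv, mul_assoc]
  rw [e, ((hasDerivAt_profile_space one_ne_zero r x).const_mul _).deriv]
  ring

/-! ### Uniqueness of bounded classical solutions -/

/-- A left-sided maximum has nonnegative derivative. -/
lemma deriv_nonneg_of_forall_le_left {h : ℝ → ℝ} {d a b : ℝ} (hab : a < b)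
    (hd : HasDerivAt h d b) (hm : ∀ t ∈ Ioo a b, h t ≤ h b) : 0 ≤ d := by
  have h1 : Tendsto (slope h b) (𝓝[<] b) (𝓝 d) :=
    (hasDerivAt_iff_tendsto_slope.1 hd).mono_left
      (nhdsWithin_mono _ fun t (ht : t < b) => ht.ne)
  refine ge_of_tendsto h1 ?_
  filter_upwards [Ioo_mem_nhdsLT hab] with t ht
  rw [slope_def_field]
  exact div_nonneg_of_nonpos (sub_nonpos.2 (hm t ht)) (sub_nonpos.2 ht.2.le)

/-- At a local maximum the second derivative is nonpositive: otherwise the point would also be a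
local minimum, and the function locally constant. -/
lemma deriv_deriv_nonpos_of_isLocalMax {f : ℝ → ℝ} {x : ℝ} (hf : ContinuousAt f x)
    (hm : IsLocalMax f x) : deriv (deriv f) x ≤ 0 := by
  by_contra! h
  have hmin := isLocalMin_of_deriv_deriv_pos h hm.deriv_eq_zero hf
  have hc : f =ᶠ[𝓝 x] fun _ => f x := by
    filter_upwards [hm, hmin] with y h1 h2 using le_antisymm h1 h2
  rw [hc.deriv.deriv_eq] at h
  simp at h

lemma iteratedDeriv_two (f : ℝ → ℝ) : iteratedDeriv 2 f = deriv (deriv f) := by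
  rw [iteratedDeriv_succ, iteratedDeriv_one]

/-- The weak maximum principle against the strict supersolution `ε (x² + 3t)`, which dominates the
bounded function `w` for `x ≥ R`. -/
lemma le_barrier {T : ℝ} {w : ℝ → ℝ → ℝ} (hw : IsHeatSolution T 0 w) {M R ε S : ℝ}
    (hM : ∀ t ∈ Icc 0 T, ∀ x ∈ Ioi (0 : ℝ), |w t x| ≤ M) (hε : 0 < ε) (hR : M ≤ ε * R ^ 2)
    (hS : S < T) {t x : ℝ} (ht : t ∈ Icc 0 S) (hx : x ∈ Ioc 0 R) :
    w t x ≤ ε * (x ^ 2 + 3 * t) := by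
  -- The extension of `w` by its boundary value is continuous up to `x = 0`.
  set W : ℝ × ℝ → ℝ := fun z => if 0 < z.2 then w z.1 z.2 else 0 with hW
  have hWpos : ∀ {t x : ℝ}, 0 < x → W (t, x) = w t x := fun h => if_pos h
  have hWc : ContinuousOn W (Icc 0 S ×ˢ Icc 0 R) := by
    rintro ⟨t, x⟩ ⟨ht, hx⟩
    have ht' : t ∈ Icc 0 T := ⟨ht.1, ht.2.trans hS.le⟩
    rcases hx.1.eq_or_lt with h0 | h0
    · obtain rfl : 0 = x := h0
      have hsub : Icc 0 S ×ˢ Icc 0 R ⊆ (Icc 0 T ×ˢ Ioi 0) ∪ {z : ℝ × ℝ | z.2 ≤ 0} := by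
        rintro ⟨s, y⟩ ⟨hs, _⟩
        rcases lt_or_ge 0 y with h | h
        · exact Or.inl ⟨⟨hs.1, hs.2.trans hS.le⟩, h⟩
        · exact Or.inr h
      refine ContinuousWithinAt.mono ?_ hsub
      have hW0 : W (t, 0) = 0 := if_neg (lt_irrefl _)
      rw [continuousWithinAt_union]
      constructor
      · rw [ContinuousWithinAt, hW0]
        refine (hw.boundary t ht').congr' ?_
        filter_upwards [self_mem_nhdsWithin] with z hz using (hWpos hz.2).symm
      · rw [ContinuousWithinAt, hW0]
        refine tendsto_const_nhds.congr' ?_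
        filter_upwards [self_mem_nhdsWithin] with z hz using (if_neg (not_lt.2 hz)).symm
    · have h1 : ContinuousWithinAt (fun z : ℝ × ℝ => w z.1 z.2) (Icc 0 S ×ˢ Icc 0 R) (t, x) := by
        have h2 := hw.continuousOn (t, x) ⟨ht', h0⟩
        refine h2.mono_of_mem_nhdsWithin ?_
        have h3 : {z : ℝ × ℝ | 0 < z.2} ∈ 𝓝 (t, x) :=
          (isOpen_lt continuous_const continuous_snd).mem_nhds h0
        filter_upwards [self_mem_nhdsWithin, mem_nhdsWithin_of_mem_nhds h3] with z hz hz2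
        exact ⟨⟨hz.1.1, hz.1.2.trans hS.le⟩, hz2⟩
      refine h1.congr_of_eventuallyEq ?_ (hWpos h0)
      have h3 : {z : ℝ × ℝ | 0 < z.2} ∈ 𝓝 (t, x) :=
        (isOpen_lt continuous_const continuous_snd).mem_nhds h0
      filter_upwards [mem_nhdsWithin_of_mem_nhds h3] with z hz using hWpos hz
  set Z : ℝ × ℝ → ℝ := fun z => W z - ε * (z.2 ^ 2 + 3 * z.1) with hZ
  have hZc : ContinuousOn Z (Icc 0 S ×ˢ Icc 0 R) := hWc.sub (by fun_prop)
  obtain ⟨⟨t0, x0⟩, ⟨ht0, hx0⟩, hmax⟩ := (isCompact_Icc.prod isCompact_Icc).exists_isMaxOn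
    ⟨(t, x), ht, hx.1.le, hx.2⟩ hZc
  simp only at ht0 hx0
  have key : Z (t0, x0) ≤ 0 := by
    by_contra! hpos
    have ht0T : t0 ∈ Icc 0 T := ⟨ht0.1, ht0.2.trans hS.le⟩
    have hx0p : 0 < x0 := by
      refine hx0.1.lt_of_ne fun h => ?_
      rw [← h] at hpos
      simp only [hZ, hW, lt_irrefl, if_false] at hpos
      nlinarith [mul_nonneg hε.le ht0.1]
    have ht0p : 0 < t0 := by
      refine ht0.1.lt_of_ne fun h => ?_
      rw [← h] at hpos
      simp only [hZ, hWpos hx0p, hw.initial x0 hx0p] at hpos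
      nlinarith [mul_nonneg hε.le (sq_nonneg x0)]
    have hx0R : x0 < R := by
      refine hx0.2.lt_of_ne fun h => ?_
      simp only [hZ, hWpos hx0p] at hpos
      have h1 := (abs_le.1 (hM t0 ht0T x0 hx0p)).2
      rw [h] at h1 hpos
      nlinarith [mul_nonneg hε.le ht0.1]
    have ht0I : t0 ∈ Ioo 0 T := ⟨ht0p, ht0.2.trans_lt hS⟩
    have hle : ∀ s ∈ Icc 0 S, ∀ y ∈ Ioo 0 R, w s y - ε * (y ^ 2 + 3 * s) ≤
        w t0 x0 - ε * (x0 ^ 2 + 3 * t0) := by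
      intro s hs y hy
      have h1 := hmax (show (s, y) ∈ Icc 0 S ×ˢ Icc 0 R from ⟨hs, hy.1.le, hy.2.le⟩)
      simpa only [hZ, mem_ofPred_eq, hWpos hy.1, hWpos hx0p] using h1
    -- Time derivative at the maximum.
    have hdt : HasDerivAt (fun s => w s x0 - ε * (x0 ^ 2 + 3 * s))
        (deriv (fun s => w s x0) t0 - ε * 3) t0 := by
      have h1 := (((hasDerivAt_id t0).const_mul 3).const_add (x0 ^ 2)).const_mul ε
      simp only [mul_one, id] at h1
      exact (hw.time_diff t0 ht0I x0 hx0p).hasDerivAt.sub h1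
    have h1 := deriv_nonneg_of_forall_le_left ht0p hdt fun s hs =>
      hle s ⟨hs.1.le, hs.2.le.trans ht0.2⟩ x0 ⟨hx0p, hx0R⟩
    -- Second space derivative at the maximum.
    have hcd := hw.space_diff t0 ht0I x0 hx0p
    have hpoly : ContDiff ℝ 2 fun y : ℝ => ε * (y ^ 2 + 3 * t0) := by fun_prop
    have h2 : deriv (deriv fun y => w t0 y - ε * (y ^ 2 + 3 * t0)) x0 ≤ 0 := by
      refine deriv_deriv_nonpos_of_isLocalMax
        (hcd.continuousAt.sub hpoly.continuous.continuousAt) ?_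
      filter_upwards [Ioo_mem_nhds hx0p hx0R] with y hy using hle t0 ht0 y hy
    rw [← iteratedDeriv_two, iteratedDeriv_fun_sub hcd hpoly.contDiffAt, ← hw.heat_eq t0 ht0I x0 hx0p,
      iteratedDeriv_two] at h2
    have e1 : deriv (fun y : ℝ => ε * (y ^ 2 + 3 * t0)) = fun y => ε * (2 * y) := by
      ext y
      simp
    have e2 : deriv (fun y : ℝ => ε * (2 * y)) x0 = ε * 2 := by
      simp
    rw [e1, e2] at h2
    linarith
  have h1 := (hmax (show (t, x) ∈ Icc 0 S ×ˢ Icc 0 R from ⟨ht, hx.1.le, hx.2⟩)).trans key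
  simp only [hZ, hWpos hx.1] at h1
  linarith

/-- A bounded solution with zero data is nonpositive: let `ε → 0` in `le_barrier`, and then the final
time by continuity. -/
lemma nonpos_of_isHeatSolution_zero {T : ℝ} {w : ℝ → ℝ → ℝ} (hw : IsHeatSolution T 0 w)
    {t x : ℝ} (ht : t ∈ Icc 0 T) (hx : 0 < x) : w t x ≤ 0 := by
  obtain ⟨M, hM⟩ := hw.bounded
  have hlt : ∀ s ∈ Ico 0 T, w s x ≤ 0 := by
    intro s hs
    have h1 : Tendsto (fun ε : ℝ => ε * (x ^ 2 + 3 * s)) (𝓝[>] 0) (𝓝 0) := by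
      have : Tendsto (fun ε : ℝ => ε * (x ^ 2 + 3 * s)) (𝓝 0) (𝓝 (0 * (x ^ 2 + 3 * s))) :=
        (continuous_id.mul continuous_const).tendsto _
      rw [zero_mul] at this
      exact this.mono_left nhdsWithin_le_nhds
    refine ge_of_tendsto h1 ?_
    filter_upwards [self_mem_nhdsWithin] with ε hε
    have hε : 0 < ε := hε
    refine le_barrier hw hM hε (R := max x (√(M / ε))) ?_ hs.2 ⟨hs.1, le_rfl⟩
      ⟨hx, le_max_left _ _⟩
    rcases le_or_gt M 0 with h | h
    · exact h.trans (by positivity)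
    · calc M = ε * √(M / ε) ^ 2 := by rw [Real.sq_sqrt (by positivity)]; field_simp
        _ ≤ _ := by gcongr; exact le_max_right _ _
  rcases ht.2.eq_or_lt with rfl | h
  · rcases ht.1.eq_or_lt with rfl | h0
    · rw [hw.initial x hx]
    have hc : ContinuousWithinAt (fun s => w s x) (Ioo 0 t) t := by
      have h1 := hw.continuousOn (t, x) ⟨ht, hx⟩
      exact h1.comp (f := fun s : ℝ => (s, x)) (Continuous.continuousWithinAt (by fun_prop))
        fun s hs => ⟨Ioo_subset_Icc_self hs, hx⟩
    have : (𝓝[Ioo 0 t] t).NeBot := by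
      rw [nhdsWithin_Ioo_eq_nhdsLT h0]; infer_instance
    refine le_of_tendsto hc ?_
    filter_upwards [self_mem_nhdsWithin] with s hs using hlt s ⟨hs.1.le, hs.2⟩
  · exact hlt t ⟨ht.1, h⟩

lemma isHeatSolution_sub {T : ℝ} {ψ : ℝ → ℝ} {u v : ℝ → ℝ → ℝ} (hu : IsHeatSolution T ψ u)
    (hv : IsHeatSolution T ψ v) : IsHeatSolution T 0 fun t x => u t x - v t x where
  bounded := by
    obtain ⟨M, hM⟩ := hu.bounded
    obtain ⟨N, hN⟩ := hv.bounded
    exact ⟨M + N, fun t ht x hx => (abs_sub _ _).trans (add_le_add (hM t ht x hx) (hN t ht x hx))⟩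
  continuousOn := hu.continuousOn.sub hv.continuousOn
  time_diff t ht x hx := (hu.time_diff t ht x hx).sub (hv.time_diff t ht x hx)
  space_diff t ht x hx := (hu.space_diff t ht x hx).sub (hv.space_diff t ht x hx)
  heat_eq t ht x hx := by
    rw [iteratedDeriv_fun_sub (hu.space_diff t ht x hx) (hv.space_diff t ht x hx),
      deriv_fun_sub (hu.time_diff t ht x hx) (hv.time_diff t ht x hx), hu.heat_eq t ht x hx,
      hv.heat_eq t ht x hx]
  initial x hx := by rw [hu.initial x hx, hv.initial x hx, sub_zero]
  boundary t ht := by simpa using (hu.boundary t ht).sub (hv.boundary t ht)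

theorem isHeatSolution_unique {T : ℝ} {ψ : ℝ → ℝ} {u v : ℝ → ℝ → ℝ} (hu : IsHeatSolution T ψ u)
    (hv : IsHeatSolution T ψ v) {t x : ℝ} (ht : t ∈ Icc 0 T) (hx : 0 < x) : u t x = v t x :=
  le_antisymm
    (sub_nonpos.1 (nonpos_of_isHeatSolution_zero (isHeatSolution_sub hu hv) ht hx))
    (sub_nonpos.1 (nonpos_of_isHeatSolution_zero (isHeatSolution_sub hv hu) ht hx))

/-! ### Layer potentials and existence -/

/-- The layer potential of the datum `Ψ` on `(0,T]` with kernel `profile n`. For `t ≤ T` only times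
`τ < t` contribute, since `profile n (t - τ)` vanishes for `τ ≥ t`. -/
noncomputable def layer (T : ℝ) (Ψ : ℝ → ℝ) (n : ℕ) (t x : ℝ) : ℝ :=
  ∫ τ in Ioc 0 T, profile n (t - τ) x * Ψ τ

section Layer

variable {T : ℝ} {Ψ : ℝ → ℝ} {A : ℝ} {n : ℕ}

lemma abs_profile_mul_le (hA : ∀ τ, |Ψ τ| ≤ A) (hn : n ≠ 0) (r τ : ℝ) {x y : ℝ} (hy : 0 < y)
    (hyx : y ≤ x) : |profile n r x * Ψ τ| ≤ Real.exp 1 * n.factorial / y ^ n * A := by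
  rw [abs_mul, abs_of_nonneg (profile_nonneg _ _ _)]
  refine mul_le_mul ((profile_le hn r (hy.trans_le hyx)).trans ?_) (hA τ) (abs_nonneg _)
    (by positivity)
  gcongr

lemma aestronglyMeasurable_profile_mul (hΨ : Continuous Ψ) (n : ℕ) (t x : ℝ) (μ : Measure ℝ) :
    AEStronglyMeasurable (fun τ => profile n (t - τ) x * Ψ τ) μ := by
  have := hΨ.measurable
  have h : Measurable fun τ => profile n (t - τ) x :=
    (measurable_profile n x).comp (measurable_const.sub measurable_id)
  exact (h.mul this).aestronglyMeasurable

lemma integrableOn_profile_mul (hΨ : Continuous Ψ) (hA : ∀ τ, |Ψ τ| ≤ A) (hn : n ≠ 0) (t : ℝ)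
    {x : ℝ} (hx : 0 < x) : IntegrableOn (fun τ => profile n (t - τ) x * Ψ τ) (Ioc 0 T) :=
  Measure.integrableOn_of_bounded (by simp) (aestronglyMeasurable_profile_mul hΨ n t x _)
    (Eventually.of_forall fun τ => abs_profile_mul_le hA hn (t - τ) τ hx le_rfl)

lemma abs_layer_le (hT : 0 ≤ T) (hA : ∀ τ, |Ψ τ| ≤ A) (hn : n ≠ 0)
    (t : ℝ) {x : ℝ} (hx : 0 < x) :
    |layer T Ψ n t x| ≤ Real.exp 1 * n.factorial / x ^ n * A * T := by
  have h := norm_setIntegral_le_of_norm_le_const (μ := volume) (s := Ioc 0 T)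
    (f := fun τ => profile n (t - τ) x * Ψ τ) (by simp)
    fun τ _ => abs_profile_mul_le hA hn (t - τ) τ hx le_rfl
  simpa [layer, hT] using h

lemma hasDerivAt_layer_space (hΨ : Continuous Ψ) (hA : ∀ τ, |Ψ τ| ≤ A) (hn : n ≠ 0) (t : ℝ)
    {x : ℝ} (hx : 0 < x) :
    HasDerivAt (fun y => layer T Ψ n t y) (-(x / 2) * layer T Ψ (n + 2) t x) x := by
  have hA0 : 0 ≤ A := (abs_nonneg _).trans (hA 0)
  have h := (hasDerivAt_integral_of_dominated_loc_of_deriv_le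
    (μ := volume.restrict (Ioc 0 T)) (F := fun y τ => profile n (t - τ) y * Ψ τ)
    (F' := fun y τ => -(y / 2) * (profile (n + 2) (t - τ) y * Ψ τ)) (x₀ := x)
    (s := Ioo (x / 2) (2 * x))
    (bound := fun _ => x * (Real.exp 1 * (n + 2).factorial / (x / 2) ^ (n + 2) * A))
    (Ioo_mem_nhds (by linarith) (by linarith))
    (Eventually.of_forall fun y => aestronglyMeasurable_profile_mul hΨ n t y _)
    (integrableOn_profile_mul hΨ hA hn t hx)
    ((aestronglyMeasurable_profile_mul hΨ _ t x _).const_mul _) ?_ (integrable_const _) ?_).2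
  · rwa [integral_const_mul] at h
  · refine Eventually.of_forall fun τ y hy => ?_
    have hy0 : 0 < y := by linarith [hy.1]
    rw [norm_mul, norm_neg, Real.norm_of_nonneg (by positivity : 0 ≤ y / 2)]
    refine mul_le_mul (by linarith [hy.2]) ?_ (norm_nonneg _) hx.le
    exact abs_profile_mul_le hA (by omega) _ _ (by positivity) hy.1.le
  · refine Eventually.of_forall fun τ y _ => ?_
    exact ((hasDerivAt_profile_space hn (t - τ) y).mul_const (Ψ τ)).congr_deriv (by ring)

lemma hasDerivAt_layer_time (hΨ : Continuous Ψ) (hA : ∀ τ, |Ψ τ| ≤ A) (hn : n ≠ 0) (t : ℝ)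
    {x : ℝ} (hx : 0 < x) :
    HasDerivAt (fun s => layer T Ψ n s x)
      (-(n / 2) * layer T Ψ (n + 2) t x + x ^ 2 / 4 * layer T Ψ (n + 4) t x) t := by
  have h := (hasDerivAt_integral_of_dominated_loc_of_deriv_le
    (μ := volume.restrict (Ioc 0 T)) (F := fun s τ => profile n (s - τ) x * Ψ τ)
    (F' := fun s τ => -(n / 2) * (profile (n + 2) (s - τ) x * Ψ τ)
      + x ^ 2 / 4 * (profile (n + 4) (s - τ) x * Ψ τ)) (x₀ := t) (s := univ)
    (bound := fun _ => n / 2 * (Real.exp 1 * (n + 2).factorial / x ^ (n + 2) * A)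
      + x ^ 2 / 4 * (Real.exp 1 * (n + 4).factorial / x ^ (n + 4) * A))
    univ_mem
    (Eventually.of_forall fun s => aestronglyMeasurable_profile_mul hΨ n s x _)
    (integrableOn_profile_mul hΨ hA hn t hx)
    (((aestronglyMeasurable_profile_mul hΨ _ t x _).const_mul _).add
      ((aestronglyMeasurable_profile_mul hΨ _ t x _).const_mul _)) ?_ (integrable_const _) ?_).2
  · rwa [integral_add
      ((integrableOn_profile_mul hΨ hA (by omega) t hx).const_mul _)
      ((integrableOn_profile_mul hΨ hA (by omega) t hx).const_mul _),
      integral_const_mul, integral_const_mul] at h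
  · refine Eventually.of_forall fun τ s _ => (norm_add_le _ _).trans (add_le_add ?_ ?_)
    · rw [norm_mul, norm_neg, Real.norm_of_nonneg (by positivity : (0 : ℝ) ≤ n / 2)]
      gcongr
      exact abs_profile_mul_le hA (by omega) _ _ hx le_rfl
    · rw [norm_mul, Real.norm_of_nonneg (by positivity : 0 ≤ x ^ 2 / 4)]
      gcongr
      exact abs_profile_mul_le hA (by omega) _ _ hx le_rfl
  · refine Eventually.of_forall fun τ s _ => ?_
    exact (((hasDerivAt_profile_time hn (s - τ) hx).comp_sub_const s τ).mul_const (Ψ τ)).congr_deriv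
      (by ring)

lemma contDiffOn_layer (hΨ : Continuous Ψ) (hA : ∀ τ, |Ψ τ| ≤ A) (hn : n ≠ 0) (t : ℝ) (m : ℕ) :
    ContDiffOn ℝ m (layer T Ψ n t) (Ioi 0) := by
  have hd : ∀ {n : ℕ}, n ≠ 0 → DifferentiableOn ℝ (layer T Ψ n t) (Ioi 0) := fun hn x hx =>
    (hasDerivAt_layer_space hΨ hA hn t hx).differentiableAt.differentiableWithinAt
  induction m generalizing n with
  | zero => exact contDiffOn_zero.2 (hd hn).continuousOn
  | succ m ih =>
    push_cast
    refine (contDiffOn_succ_iff_deriv_of_isOpen isOpen_Ioi).2 ⟨hd hn, by simp, ?_⟩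
    refine ContDiffOn.congr (f := fun x => -(x / 2) * layer T Ψ (n + 2) t x)
      (ContDiffOn.mul (by fun_prop) (ih (by omega))) fun x hx => ?_
    exact (hasDerivAt_layer_space hΨ hA hn t hx).deriv

/-- The layer potential in parabolically rescaled time. -/
lemma layer_eq_scaled (h0 : ∀ τ ≤ 0, Ψ τ = 0) (hn : n ≠ 0) {t x : ℝ} (ht : t ≤ T) (hx : 0 < x) :
    layer T Ψ n t x = x ^ 2 * (x ^ n)⁻¹ * ∫ ρ, profile n ρ 1 * Ψ (t - x ^ 2 * ρ) := by
  have h1 : layer T Ψ n t x = ∫ τ, profile n (t - τ) x * Ψ τ := by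
    refine setIntegral_eq_integral_of_forall_compl_eq_zero fun τ hτ => ?_
    rcases le_or_gt τ 0 with h | h
    · rw [h0 τ h, mul_zero]
    · have : T < τ := not_le.1 fun hT => hτ ⟨h, hT⟩
      rw [profile_of_nonpos hn (by linarith), zero_mul]
  have h2 := integral_sub_left_eq_self (fun r => profile n r x * Ψ (t - r)) volume t
  simp only [sub_sub_cancel] at h2
  have h3 := Measure.integral_comp_mul_left (fun r => profile n r x * Ψ (t - r)) (x ^ 2)
  rw [h1, h2]
  simp only [profile_scale n _ hx, mul_assoc, integral_const_mul, smul_eq_mul] at h3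
  rw [abs_of_pos (by positivity), eq_inv_mul_iff_mul_eq₀ (by positivity)] at h3
  rw [← h3, mul_assoc]

end Layer

/-- The solution with datum `Ψ`. -/
noncomputable def sol (T : ℝ) (Ψ : ℝ → ℝ) (t x : ℝ) : ℝ :=
  (√(4 * Real.pi))⁻¹ * (x * layer T Ψ 3 t x)

/-- The space derivative of `sol`. -/
noncomputable def solDeriv (T : ℝ) (Ψ : ℝ → ℝ) (t x : ℝ) : ℝ :=
  (√(4 * Real.pi))⁻¹ * (layer T Ψ 3 t x - x ^ 2 / 2 * layer T Ψ 5 t x)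

/-- The solution as an average of the datum over past times, with respect to a fixed probability
density. This makes sense for all real `t` and `x`, and has the boundary value `Ψ t` at `x = 0`. -/
noncomputable def average (Ψ : ℝ → ℝ) (t x : ℝ) : ℝ :=
  (√(4 * Real.pi))⁻¹ * ∫ ρ, profile 3 ρ 1 * Ψ (t - x ^ 2 * ρ)

section Sol

variable {T : ℝ} {Ψ : ℝ → ℝ} {A : ℝ}

lemma hasDerivAt_sol (hΨ : Continuous Ψ) (hA : ∀ τ, |Ψ τ| ≤ A) (t : ℝ) {x : ℝ} (hx : 0 < x) :
    HasDerivAt (sol T Ψ t) (solDeriv T Ψ t x) x := by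
  have h := ((hasDerivAt_id x).mul
    (hasDerivAt_layer_space (T := T) hΨ hA three_ne_zero t hx)).const_mul (√(4 * Real.pi))⁻¹
  refine h.congr_deriv ?_
  simp only [solDeriv, id]
  ring

lemma hasDerivAt_solDeriv (hΨ : Continuous Ψ) (hA : ∀ τ, |Ψ τ| ≤ A) (t : ℝ) {x : ℝ}
    (hx : 0 < x) : HasDerivAt (solDeriv T Ψ t) ((√(4 * Real.pi))⁻¹ *
      (x * (-(3 / 2) * layer T Ψ 5 t x + x ^ 2 / 4 * layer T Ψ 7 t x))) x := by
  have h := ((hasDerivAt_layer_space (T := T) hΨ hA three_ne_zero t hx).sub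
    ((((hasDerivAt_id x).pow 2).div_const 2).mul
      (hasDerivAt_layer_space (T := T) hΨ hA (n := 5) (by norm_num) t hx))).const_mul
        (√(4 * Real.pi))⁻¹
  refine h.congr_deriv ?_
  simp only [id, Pi.pow_apply]
  push_cast
  ring

lemma hasDerivAt_sol_time (hΨ : Continuous Ψ) (hA : ∀ τ, |Ψ τ| ≤ A) (t : ℝ) {x : ℝ}
    (hx : 0 < x) : HasDerivAt (fun s => sol T Ψ s x) ((√(4 * Real.pi))⁻¹ *
      (x * (-(3 / 2) * layer T Ψ 5 t x + x ^ 2 / 4 * layer T Ψ 7 t x))) t := by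
  have h := ((hasDerivAt_layer_time (T := T) hΨ hA three_ne_zero t hx).const_mul x).const_mul
    (√(4 * Real.pi))⁻¹
  exact_mod_cast h

lemma contDiffOn_sol (hΨ : Continuous Ψ) (hA : ∀ τ, |Ψ τ| ≤ A) (t : ℝ) (m : ℕ) :
    ContDiffOn ℝ m (sol T Ψ t) (Ioi 0) :=
  contDiffOn_const.mul (contDiffOn_id.mul (contDiffOn_layer hΨ hA three_ne_zero t m))

lemma average_eq_sol (h0 : ∀ τ ≤ 0, Ψ τ = 0) {t x : ℝ} (ht : t ≤ T) (hx : 0 < x) :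
    average Ψ t x = sol T Ψ t x := by
  rw [average, sol, layer_eq_scaled h0 three_ne_zero ht hx]
  field_simp

lemma continuous_average (hΨ : Continuous Ψ) (hA : ∀ τ, |Ψ τ| ≤ A) :
    Continuous fun z : ℝ × ℝ => average Ψ z.1 z.2 := by
  refine continuous_const.mul (continuous_of_dominated (bound := fun ρ => profile 3 ρ 1 * A)
    (fun z => ?_) (fun z => Eventually.of_forall fun ρ => ?_)
    ((integrable_profile le_rfl).mul_const A) (Eventually.of_forall fun ρ => by fun_prop))
  · exact ((measurable_profile 3 1).mul (hΨ.measurable.comp (by fun_prop))).aestronglyMeasurable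
  · rw [norm_mul, Real.norm_of_nonneg (profile_nonneg _ _ _)]
    exact mul_le_mul_of_nonneg_left (hA _) (profile_nonneg _ _ _)

lemma average_zero (t : ℝ) : average Ψ t 0 = Ψ t := by
  have : √(4 * Real.pi) ≠ 0 := by positivity
  simp only [average, ne_eq, OfNat.ofNat_ne_zero, not_false_eq_true, zero_pow, zero_mul, sub_zero,
    integral_mul_const, integral_profile_three]
  field_simp

lemma abs_average_le (hA : ∀ τ, |Ψ τ| ≤ A) (t x : ℝ) : |average Ψ t x| ≤ A := by
  have h : ‖∫ ρ, profile 3 ρ 1 * Ψ (t - x ^ 2 * ρ)‖ ≤ ∫ ρ, profile 3 ρ 1 * A := by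
    refine norm_integral_le_of_norm_le ((integrable_profile le_rfl).mul_const A)
      (Eventually.of_forall fun ρ => ?_)
    rw [norm_mul, Real.norm_of_nonneg (profile_nonneg _ _ _)]
    exact mul_le_mul_of_nonneg_left (hA _) (profile_nonneg _ _ _)
  rw [integral_mul_const, integral_profile_three] at h
  rw [average, abs_mul, abs_of_pos (by positivity), inv_mul_le_iff₀ (by positivity)]
  exact h

/-- The layer potential representation of the explicit solution. -/
lemma dirichletHeat_eq_sol {ψ : ℝ → ℝ} (hψ : ∀ t ∈ Icc 0 T, Ψ t = ψ t) {t : ℝ}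
    (ht : t ∈ Icc 0 T) (x : ℝ) : dirichletHeat ψ t x = sol T Ψ t x := by
  have h1 : layer T Ψ 3 t x = ∫ τ in Ioc 0 t, profile 3 (t - τ) x * ψ τ := by
    rw [layer, setIntegral_eq_of_subset_of_forall_sdiff_eq_zero measurableSet_Ioc
      (Ioc_subset_Ioc_right ht.2)]
    · refine setIntegral_congr_fun measurableSet_Ioc fun τ hτ => ?_
      simp only [hψ τ ⟨hτ.1.le, hτ.2.trans ht.2⟩]
    · intro τ hτ
      have : t < τ := not_le.1 fun h => hτ.2 ⟨hτ.1.1, h⟩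
      rw [profile_of_nonpos three_ne_zero (by linarith), zero_mul]
  rw [dirichletHeat, sol, h1, intervalIntegral.integral_of_le ht.1]
  simp only [deriv_heatKernel, mul_assoc, integral_const_mul]
  ring

theorem isHeatSolution_dirichletHeat {ψ : ℝ → ℝ} (hΨ : Continuous Ψ) (hA : ∀ τ, |Ψ τ| ≤ A)
    (h0 : ∀ τ ≤ 0, Ψ τ = 0) (hψ : ∀ t ∈ Icc 0 T, Ψ t = ψ t) :
    IsHeatSolution T ψ (dirichletHeat ψ) := by
  have hs : ∀ {t x : ℝ}, t ∈ Icc 0 T → dirichletHeat ψ t x = sol T Ψ t x := fun ht =>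
    dirichletHeat_eq_sol hψ ht _
  have ha : ∀ {t x : ℝ}, t ∈ Icc 0 T → 0 < x → dirichletHeat ψ t x = average Ψ t x :=
    fun ht hx => by rw [hs ht, average_eq_sol h0 ht.2 hx]
  have hst : ∀ {t : ℝ}, t ∈ Icc 0 T → dirichletHeat ψ t = sol T Ψ t := fun ht =>
    funext fun x => hs ht
  have htime : ∀ t ∈ Ioo 0 T, ∀ x ∈ Ioi (0 : ℝ), HasDerivAt (fun s => dirichletHeat ψ s x)
      ((√(4 * Real.pi))⁻¹ * (x * (-(3 / 2) * layer T Ψ 5 t x + x ^ 2 / 4 * layer T Ψ 7 t x))) t := by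
    intro t ht x hx
    refine (hasDerivAt_sol_time hΨ hA t hx).congr_of_eventuallyEq ?_
    filter_upwards [Ioo_mem_nhds ht.1 ht.2] with s hs' using hs ⟨hs'.1.le, hs'.2.le⟩
  refine ⟨⟨A, fun t ht x hx => ?_⟩, ?_, fun t ht x hx => (htime t ht x hx).differentiableAt,
    fun t ht x hx => ?_, fun t ht x hx => ?_, fun x hx => ?_, fun t ht => ?_⟩
  · rw [ha ht hx]
    exact abs_average_le hA t x
  · exact (continuous_average hΨ hA).continuousOn.congr fun z hz => ha hz.1 hz.2
  · rw [hst ⟨ht.1.le, ht.2.le⟩]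
    exact (contDiffOn_sol hΨ hA t 2).contDiffAt (Ioi_mem_nhds hx)
  · rw [(htime t ht x hx).deriv, hst ⟨ht.1.le, ht.2.le⟩, iteratedDeriv_succ, iteratedDeriv_one]
    refine Eq.symm (HasDerivAt.deriv ?_)
    refine (hasDerivAt_solDeriv hΨ hA t hx).congr_of_eventuallyEq ?_
    filter_upwards [Ioi_mem_nhds hx] with y hy using (hasDerivAt_sol hΨ hA t hy).deriv
  · simp [dirichletHeat]
  · have h1 : Tendsto (fun z : ℝ × ℝ => average Ψ z.1 z.2) (𝓝 (t, 0)) (𝓝 (average Ψ t 0)) :=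
      (continuous_average hΨ hA).tendsto (t, 0)
    rw [average_zero, hψ t ht] at h1
    refine (h1.mono_left nhdsWithin_le_nhds).congr' ?_
    filter_upwards [self_mem_nhdsWithin] with z hz using (ha hz.1 hz.2).symm

end Sol

/-! ### Weighted bounds and the Sobolev estimate -/

/-- The weight that dominates the solution and its space derivative: the singularity `x^{2β-1}` at
the boundary comes from the Hölder continuity of the datum, and `x⁻²` at infinity from the decay
of the kernel on a bounded time interval. -/
noncomputable def weight (β x : ℝ) : ℝ :=
  if x ≤ 1 then x ^ (2 * β - 1) else x ^ (-2 : ℝ)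

lemma measurable_weight (β : ℝ) : Measurable (weight β) :=
  Measurable.ite measurableSet_Iic (by fun_prop) (by fun_prop)

lemma weight_nonneg (β : ℝ) {x : ℝ} (hx : 0 < x) : 0 ≤ weight β x := by
  unfold weight; split_ifs <;> positivity

lemma memLp_weight {β q : ℝ} (hβ : β < 1 / 2) (hq1 : 1 ≤ q) (hq : q < 1 / (1 - 2 * β)) :
    MemLp (weight β) (ENNReal.ofReal q) (volume.restrict (Ioi 0)) := by
  have hq0 : 0 < q := by linarith
  have hexp : -1 < (2 * β - 1) * q := by
    rw [lt_div_iff₀ (by linarith)] at hq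
    nlinarith
  rw [← integrable_norm_rpow_iff (measurable_weight β).aestronglyMeasurable
    (by simpa using hq0) ENNReal.ofReal_ne_top, ENNReal.toReal_ofReal hq0.le]
  change IntegrableOn (fun x => ‖weight β x‖ ^ q) (Ioi 0)
  rw [← Ioc_union_Ioi_eq_Ioi zero_le_one, integrableOn_union]
  constructor
  · have h1 : IntegrableOn (fun x : ℝ => x ^ ((2 * β - 1) * q)) (Ioc 0 1) :=
      (integrableOn_Ioc_iff_integrableOn_Ioo (by simp)).2
        ((intervalIntegral.integrableOn_Ioo_rpow_iff one_pos).2 hexp)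
    refine h1.congr_fun (fun x hx => ?_) measurableSet_Ioc
    simp only [weight, if_pos hx.2]
    rw [Real.norm_of_nonneg (Real.rpow_nonneg hx.1.le _), Real.rpow_mul hx.1.le]
  · have h1 : IntegrableOn (fun x : ℝ => x ^ (-2 * q)) (Ioi 1) :=
      integrableOn_Ioi_rpow_of_lt (by linarith) one_pos
    refine h1.congr_fun (fun x hx => ?_) measurableSet_Ioi
    have hx : 1 < x := hx
    have hx0 : 0 ≤ x := by linarith
    simp only [weight, if_neg (not_le.2 hx)]
    rw [Real.norm_of_nonneg (Real.rpow_nonneg hx0 _), Real.rpow_mul hx0]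

section Bounds

variable {T : ℝ} {Ψ : ℝ → ℝ} {A : ℝ}

/-- For `x ≤ 1` the maximum bound suffices since `x^{2β-1} ≥ 1`; for `x > 1` the pointwise bound on
the kernel gives the decay. -/
lemma abs_sol_le_weight (hT : 0 ≤ T) (hA : ∀ τ, |Ψ τ| ≤ A)
    (h0 : ∀ τ ≤ 0, Ψ τ = 0) {β : ℝ} (hβ : β < 1 / 2) {t x : ℝ} (ht : t ≤ T) (hx : 0 < x) :
    |sol T Ψ t x| ≤ (1 + (√(4 * Real.pi))⁻¹ * (Real.exp 1 * 6 * T)) * A * weight β x := by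
  have hA0 : 0 ≤ A := (abs_nonneg _).trans (hA 0)
  unfold weight
  split_ifs with h
  · have h1 : 1 ≤ x ^ (2 * β - 1) := Real.one_le_rpow_of_pos_of_le_one_of_nonpos hx h (by linarith)
    have h2 : |sol T Ψ t x| ≤ A := by
      rw [← average_eq_sol h0 ht hx]; exact abs_average_le hA t x
    calc |sol T Ψ t x| ≤ 1 * A * 1 := by linarith
      _ ≤ _ := by
        gcongr
        have : 0 ≤ (√(4 * Real.pi))⁻¹ * (Real.exp 1 * 6 * T) := by positivity
        linarith
  · have h1 := abs_layer_le hT hA three_ne_zero t hx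
    rw [sol, abs_mul, abs_mul, abs_of_pos hx, abs_of_pos (by positivity), Real.rpow_neg hx.le]
    calc (√(4 * Real.pi))⁻¹ * (x * |layer T Ψ 3 t x|)
        ≤ (√(4 * Real.pi))⁻¹ * (x * (Real.exp 1 * Nat.factorial 3 / x ^ 3 * A * T)) := by gcongr
      _ = (√(4 * Real.pi))⁻¹ * (Real.exp 1 * 6 * T) * A * (x ^ (2 : ℝ))⁻¹ := by
        norm_num [Nat.factorial]; field_simp
      _ ≤ _ := by gcongr; linarith

/-- The cancellation of the kernel turns the space derivative into an average of increments of the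
datum. -/
lemma solDeriv_eq_average_sub (hΨ : Continuous Ψ) (hA : ∀ τ, |Ψ τ| ≤ A) (h0 : ∀ τ ≤ 0, Ψ τ = 0)
    {t x : ℝ} (ht : t ≤ T) (hx : 0 < x) :
    solDeriv T Ψ t x = (√(4 * Real.pi))⁻¹ * (x⁻¹ *
      ∫ ρ, (profile 3 ρ 1 - 1 / 2 * profile 5 ρ 1) * (Ψ (t - x ^ 2 * ρ) - Ψ t)) := by
  have hi : ∀ {n : ℕ}, 3 ≤ n → Integrable fun ρ => profile n ρ 1 * Ψ (t - x ^ 2 * ρ) :=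
    fun hn => (integrable_profile hn).mul_bdd (c := A)
      (hΨ.comp (by fun_prop)).aestronglyMeasurable (Eventually.of_forall fun ρ => hA _)
  have h3 := hi le_rfl
  have h5 := hi (n := 5) (by norm_num)
  have hk : Integrable fun ρ => profile 3 ρ 1 - 1 / 2 * profile 5 ρ 1 :=
    (integrable_profile le_rfl).sub ((integrable_profile (by norm_num)).const_mul _)
  have h35 : Integrable fun ρ => profile 3 ρ 1 * Ψ (t - x ^ 2 * ρ)
      - 1 / 2 * (profile 5 ρ 1 * Ψ (t - x ^ 2 * ρ)) := h3.sub (h5.const_mul _)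
  have e : (fun ρ => (profile 3 ρ 1 - 1 / 2 * profile 5 ρ 1) * (Ψ (t - x ^ 2 * ρ) - Ψ t)) =
      fun ρ => (profile 3 ρ 1 * Ψ (t - x ^ 2 * ρ) - 1 / 2 * (profile 5 ρ 1 * Ψ (t - x ^ 2 * ρ)))
        - (profile 3 ρ 1 - 1 / 2 * profile 5 ρ 1) * Ψ t := by
    ext ρ; ring
  rw [e, integral_sub h35 (hk.mul_const _),
    integral_sub h3 (h5.const_mul _), integral_const_mul, integral_mul_const,
    integral_profile_cancel, zero_mul, sub_zero, solDeriv,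
    layer_eq_scaled h0 three_ne_zero ht hx, layer_eq_scaled h0 (by norm_num) ht hx]
  field_simp

/-- The `β`-moment of the profile `Φ₃ + Φ₅/2`, which dominates the absolute value of the profile
`Φ₃ - Φ₅/2` of `∂ₓ²G`. -/
noncomputable def moment (β : ℝ) : ℝ :=
  ∫ ρ, (profile 3 ρ 1 + 1 / 2 * profile 5 ρ 1) * |ρ| ^ β

lemma moment_nonneg (β : ℝ) : 0 ≤ moment β := by
  refine integral_nonneg fun ρ => ?_
  have h3 := profile_nonneg 3 ρ 1
  have h5 := profile_nonneg 5 ρ 1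
  simp only [Pi.zero_apply]
  positivity

/-- The Hölder bound on the increments, at the time lag `x² ρ`, produces the factor `x^{2β}`. -/
lemma abs_solDeriv_le_near (hΨ : Continuous Ψ) (hA : ∀ τ, |Ψ τ| ≤ A) (h0 : ∀ τ ≤ 0, Ψ τ = 0)
    {β : ℝ} (hβ0 : 0 ≤ β) (hβ : β < 1 / 2) (hH : ∀ a b, |Ψ a - Ψ b| ≤ A * |a - b| ^ β)
    {t x : ℝ} (ht : t ≤ T) (hx : 0 < x) :
    |solDeriv T Ψ t x| ≤ (√(4 * Real.pi))⁻¹ * moment β * A * x ^ (2 * β - 1) := by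
  have hint : ‖∫ ρ, (profile 3 ρ 1 - 1 / 2 * profile 5 ρ 1) * (Ψ (t - x ^ 2 * ρ) - Ψ t)‖ ≤
      ∫ ρ, (profile 3 ρ 1 + 1 / 2 * profile 5 ρ 1) * |ρ| ^ β * (A * x ^ (2 * β)) := by
    refine norm_integral_le_of_norm_le (Integrable.mul_const ?_ _)
      (Eventually.of_forall fun ρ => ?_)
    · simp only [add_mul, mul_assoc]
      exact (integrable_profile_mul_rpow le_rfl hβ0 hβ).add
        ((integrable_profile_mul_rpow (by norm_num) hβ0 hβ).const_mul _)
    · have h3 := profile_nonneg 3 ρ 1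
      have h5 := profile_nonneg 5 ρ 1
      have h1 : |profile 3 ρ 1 - 1 / 2 * profile 5 ρ 1| ≤
          profile 3 ρ 1 + 1 / 2 * profile 5 ρ 1 := abs_le.2 ⟨by linarith, by linarith⟩
      have h2 : |Ψ (t - x ^ 2 * ρ) - Ψ t| ≤ |ρ| ^ β * (A * x ^ (2 * β)) := by
        refine (hH _ _).trans_eq ?_
        rw [show t - x ^ 2 * ρ - t = -(x ^ 2 * ρ) by ring, abs_neg, abs_mul,
          abs_of_pos (by positivity : 0 < x ^ 2), Real.mul_rpow (by positivity) (abs_nonneg _),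
          ← Real.rpow_natCast x 2, ← Real.rpow_mul hx.le]
        push_cast
        ring
      rw [norm_mul, mul_assoc]
      exact mul_le_mul h1 h2 (abs_nonneg _) (by positivity)
  rw [integral_mul_const] at hint
  rw [solDeriv_eq_average_sub hΨ hA h0 ht hx, abs_mul, abs_mul, abs_of_pos (inv_pos.2 hx),
    abs_of_pos (by positivity)]
  calc _ ≤ (√(4 * Real.pi))⁻¹ * (x⁻¹ * (moment β * (A * x ^ (2 * β)))) := by
        gcongr; exact hint
    _ = _ := by rw [Real.rpow_sub hx, Real.rpow_one]; ring

/-- The constant is `3! + 5!/2 = 66`, from the bounds on the layers with `n = 3` and `n = 5`. -/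
lemma abs_solDeriv_le_far (hT : 0 ≤ T) (hA : ∀ τ, |Ψ τ| ≤ A)
    (t : ℝ) {x : ℝ} (hx : 0 < x) :
    |solDeriv T Ψ t x| ≤ (√(4 * Real.pi))⁻¹ * (Real.exp 1 * 66 * T) * A * (x ^ 3)⁻¹ := by
  have h3 := abs_layer_le hT hA three_ne_zero t hx
  have h5 := abs_layer_le hT hA (n := 5) (by norm_num) t hx
  rw [solDeriv, abs_mul, abs_of_pos (by positivity)]
  calc (√(4 * Real.pi))⁻¹ * |layer T Ψ 3 t x - x ^ 2 / 2 * layer T Ψ 5 t x|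
      ≤ (√(4 * Real.pi))⁻¹ * (|layer T Ψ 3 t x| + x ^ 2 / 2 * |layer T Ψ 5 t x|) := by
        gcongr
        refine (abs_sub _ _).trans_eq ?_
        rw [abs_mul, abs_of_nonneg (by positivity : 0 ≤ x ^ 2 / 2)]
    _ ≤ (√(4 * Real.pi))⁻¹ * (Real.exp 1 * Nat.factorial 3 / x ^ 3 * A * T +
          x ^ 2 / 2 * (Real.exp 1 * Nat.factorial 5 / x ^ 5 * A * T)) := by gcongr
    _ = _ := by norm_num [Nat.factorial]; field_simp; ring

lemma abs_solDeriv_le_weight (hT : 0 ≤ T) (hΨ : Continuous Ψ) (hA : ∀ τ, |Ψ τ| ≤ A)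
    (h0 : ∀ τ ≤ 0, Ψ τ = 0) {β : ℝ} (hβ0 : 0 ≤ β) (hβ : β < 1 / 2)
    (hH : ∀ a b, |Ψ a - Ψ b| ≤ A * |a - b| ^ β) {t x : ℝ} (ht : t ≤ T) (hx : 0 < x) :
    |solDeriv T Ψ t x| ≤
      (√(4 * Real.pi))⁻¹ * (moment β + Real.exp 1 * 66 * T) * A * weight β x := by
  have hA0 : 0 ≤ A := (abs_nonneg _).trans (hA 0)
  have hm := moment_nonneg β
  unfold weight
  split_ifs with h
  · refine (abs_solDeriv_le_near hΨ hA h0 hβ0 hβ hH ht hx).trans ?_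
    gcongr
    have : 0 ≤ Real.exp 1 * 66 * T := by positivity
    linarith
  · refine (abs_solDeriv_le_far hT hA t hx).trans ?_
    have h1 : (x ^ 3)⁻¹ ≤ x ^ (-2 : ℝ) := by
      rw [Real.rpow_neg hx.le, Real.rpow_two]
      exact inv_anti₀ (by positivity) (pow_le_pow_right₀ (not_le.1 h).le (by norm_num))
    gcongr
    linarith

end Bounds

/-- A classical derivative on the open half-line is a weak one. -/
lemma isWeakDerivHalfLine_of_hasDerivAt {f g : ℝ → ℝ} (hf : ∀ x ∈ Ioi (0 : ℝ), HasDerivAt f (g x) x)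
    (hg : ContinuousOn g (Ioi 0)) : IsWeakDerivHalfLine f g := by
  have hfc : ContinuousOn f (Ioi 0) := fun x hx => (hf x hx).continuousAt.continuousWithinAt
  refine ⟨hfc.locallyIntegrableOn measurableSet_Ioi, hg.locallyIntegrableOn measurableSet_Ioi,
    fun φ hφ hc hs => ?_⟩
  have hφ' : Continuous (deriv φ) := hφ.continuous_deriv (by simp)
  have hint : ∀ {h η : ℝ → ℝ}, ContinuousOn h (Ioi 0) → Continuous η → tsupport η ⊆ tsupport φ →
      IntegrableOn (h * η) (Ioi 0) := by
    intro h η hh hη hsub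
    have hK : IsCompact (tsupport φ) := hc
    have h1 : IntegrableOn (h * η) (tsupport φ) :=
      ((hh.mono hs).mul hη.continuousOn).integrableOn_compact hK
    refine (IntegrableOn.integrable_of_forall_notMem_eq_zero h1 fun x hx => ?_).integrableOn
    simp [image_eq_zero_of_notMem_tsupport fun h => hx (hsub h)]
  have hzero : f * φ =ᶠ[𝓝[>] 0] 0 := by
    have h1 : (tsupport φ)ᶜ ∈ 𝓝 (0 : ℝ) :=
      (isClosed_tsupport φ).isOpen_compl.mem_nhds fun h => lt_irrefl (0 : ℝ) (hs h)
    filter_upwards [mem_nhdsWithin_of_mem_nhds h1] with x hx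
    simp [image_eq_zero_of_notMem_tsupport hx]
  have htop : f * φ =ᶠ[atTop] 0 := by
    obtain ⟨R, hR⟩ := hc.isCompact.bddAbove
    filter_upwards [eventually_gt_atTop R] with x hx
    simp [image_eq_zero_of_notMem_tsupport fun h => (hR h).not_gt hx]
  have h := integral_Ioi_mul_deriv_eq_deriv_mul (a := 0) (a' := 0) (b' := 0) hf
    (fun x _ => ((hφ.differentiable (by simp)) x).hasDerivAt)
    (hint hfc hφ' (tsupport_deriv_subset (𝕜 := ℝ)))
    (hint hg hφ.continuous subset_rfl) (tendsto_const_nhds.congr' hzero.symm)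
    (tendsto_const_nhds.congr' htop.symm)
  simpa using h

/-- The Sobolev norm of a continuously differentiable function that is dominated, together with its
derivative, by multiples of a weight. -/
lemma eSobolevNorm_le {q : ℝ} (hq : 1 ≤ q) {f g w : ℝ → ℝ} {a b : ℝ}
    (hf : ∀ x ∈ Ioi (0 : ℝ), HasDerivAt f (g x) x) (hg : ContinuousOn g (Ioi 0))
    (hw : ∀ x ∈ Ioi (0 : ℝ), 0 ≤ w x) (hfw : ∀ x ∈ Ioi (0 : ℝ), |f x| ≤ a * w x)
    (hgw : ∀ x ∈ Ioi (0 : ℝ), |g x| ≤ b * w x) :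
    eSobolevNorm q f ≤ (ENNReal.ofReal a + ENNReal.ofReal b) *
      eLpNorm w (ENNReal.ofReal q) (volume.restrict (Ioi 0)) := by
  have key : ∀ {h : ℝ → ℝ} {c : ℝ}, (∀ x ∈ Ioi (0 : ℝ), |h x| ≤ c * w x) →
      eLpNorm h (ENNReal.ofReal q) (volume.restrict (Ioi 0)) ≤
        ENNReal.ofReal c * eLpNorm w (ENNReal.ofReal q) (volume.restrict (Ioi 0)) := by
    intro h c hc
    refine eLpNorm_le_mul_eLpNorm_of_ae_le_mul ?_ _
    filter_upwards [ae_restrict_mem measurableSet_Ioi] with x hx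
    rw [Real.norm_of_nonneg (hw x hx)]
    exact hc x hx
  rw [add_mul]
  exact (iInf₂_le g (isWeakDerivHalfLine_of_hasDerivAt hf hg)).trans
    ((ENNReal.rpow_add_rpow_le_add _ _ hq).trans (add_le_add (key hfw) (key hgw)))

/-- A Hölder function on `[0,T]` extends to the line, by its end values, with the same supremum and
Hölder bounds. -/
lemma exists_extension {T : ℝ} (hT : 0 ≤ T) {β : ℝ≥0} (hβ : 0 < β) {ψ : ℝ → ℝ}
    (hψ : MemHolder β ((Icc 0 T).domRestrict ψ)) (hψ0 : ψ 0 = 0) :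
    ∃ Ψ : ℝ → ℝ, ∃ A : ℝ≥0, (A : ℝ≥0∞) = eHolderNormOn T β ψ ∧ Continuous Ψ ∧ (∀ τ, |Ψ τ| ≤ A) ∧
      (∀ τ ≤ 0, Ψ τ = 0) ∧ (∀ t ∈ Icc 0 T, Ψ t = ψ t) ∧
      ∀ a b, |Ψ a - Ψ b| ≤ A * |a - b| ^ (β : ℝ) := by
  have hH := hψ.holderWith
  set N := nnHolderNorm β ((Icc 0 T).domRestrict ψ) with hN
  have hlip : ∀ s ∈ Icc 0 T, ∀ t ∈ Icc 0 T, |ψ s - ψ t| ≤ N * |s - t| ^ (β : ℝ) :=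
    fun s hs t ht => hH.dist_le ⟨s, hs⟩ ⟨t, ht⟩
  have h0T : (0 : ℝ) ∈ Icc 0 T := ⟨le_rfl, hT⟩
  have hsup : (⨆ t ∈ Icc 0 T, ‖ψ t‖ₑ) ≠ ⊤ := by
    refine ne_top_of_le_ne_top (ENNReal.ofReal_ne_top (r := N * T ^ (β : ℝ))) (iSup₂_le fun t ht => ?_)
    rw [Real.enorm_eq_ofReal_abs]
    refine ENNReal.ofReal_le_ofReal ?_
    have h := hlip t ht 0 h0T
    rw [hψ0, sub_zero, sub_zero, abs_of_nonneg ht.1] at h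
    refine h.trans ?_
    gcongr
    · exact ht.1
    · exact ht.2
  obtain ⟨S, hS⟩ : ∃ S : ℝ≥0, (S : ℝ≥0∞) = ⨆ t ∈ Icc 0 T, ‖ψ t‖ₑ :=
    ⟨_, ENNReal.coe_toNNReal hsup⟩
  have hSle : ∀ t ∈ Icc 0 T, |ψ t| ≤ S := by
    intro t ht
    have h : ‖ψ t‖ₑ ≤ S := by rw [hS]; exact le_iSup₂ (f := fun t (_ : t ∈ Icc 0 T) => ‖ψ t‖ₑ) t ht
    have h' : ‖ψ t‖₊ ≤ S := by exact_mod_cast h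
    exact h'
  set Ψ : ℝ → ℝ := fun τ => ψ (projIcc 0 T hT τ) with hΨ
  have hbd : ∀ a b, |Ψ a - Ψ b| ≤ N * |a - b| ^ (β : ℝ) := by
    intro a b
    refine (hlip _ (projIcc 0 T hT a).2 _ (projIcc 0 T hT b).2).trans ?_
    exact mul_le_mul_of_nonneg_left (Real.rpow_le_rpow (abs_nonneg _)
      (abs_projIcc_sub_projIcc hT) β.2) N.2
  refine ⟨Ψ, S + N, ?_, ?_, fun τ => ?_, fun τ hτ => ?_, fun t ht => ?_, fun a b => ?_⟩
  · rw [eHolderNormOn, ← hS, ← hψ.coe_nnHolderNorm_eq_eHolderNorm, ENNReal.coe_add]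
  · have h1 : Continuous ((Icc 0 T).domRestrict ψ) := hH.continuous hβ
    exact h1.comp continuous_projIcc
  · refine (hSle _ (projIcc 0 T hT τ).2).trans ?_
    push_cast
    linarith [N.2]
  · simp only [hΨ, projIcc_of_le_left hT hτ, hψ0]
  · simp only [hΨ, projIcc_of_mem hT ht]
  · refine (hbd a b).trans ?_
    push_cast
    gcongr
    linarith [S.2]

end HalfLineHeat

open HalfLineHeat

theorem mainTheorem4 (T : ℝ) (hT : 0 < T) (β : ℝ≥0) (hβ0 : 0 < β) (hβ : (β : ℝ) < 1 / 2)
    (q : ℝ) (hq1 : 1 ≤ q) (hq : q < 1 / (1 - 2 * (β : ℝ))) :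
    ∃ C : ℝ≥0, ∀ ψ : ℝ → ℝ, MemHolder β ((Icc 0 T).domRestrict ψ) → ψ 0 = 0 →
      IsHeatSolution T ψ (dirichletHeat ψ) ∧
      ∀ u : ℝ → ℝ → ℝ, IsHeatSolution T ψ u →
        (⨆ t ∈ Icc 0 T, eSobolevNorm q (u t)) ≤ C * eHolderNormOn T β ψ := by
  have hW := ENNReal.coe_toNNReal (memLp_weight hβ hq1 hq).eLpNorm_lt_top.ne
  set W := (eLpNorm (weight β) (ENNReal.ofReal q) (volume.restrict (Ioi 0))).toNNReal
  set c₀ : ℝ := 1 + (√(4 * Real.pi))⁻¹ * (Real.exp 1 * 6 * T)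
  set c₁ : ℝ := (√(4 * Real.pi))⁻¹ * (moment β + Real.exp 1 * 66 * T)
  refine ⟨(c₀.toNNReal + c₁.toNNReal) * W, fun ψ hψ hψ0 => ?_⟩
  obtain ⟨Ψ, A, hA, hΨ, hΨA, hΨ0, hΨψ, hH⟩ := exists_extension hT.le hβ0 hψ hψ0
  have hsol := isHeatSolution_dirichletHeat hΨ hΨA hΨ0 hΨψ
  refine ⟨hsol, fun u hu => iSup₂_le fun t ht => ?_⟩
  have hut : ∀ x ∈ Ioi (0 : ℝ), u t x = sol T Ψ t x := fun x hx =>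
    (isHeatSolution_unique hu hsol ht hx).trans (dirichletHeat_eq_sol hΨψ ht x)
  have hle := eSobolevNorm_le hq1 (f := u t) (g := solDeriv T Ψ t) (w := weight β)
    (a := c₀ * A) (b := c₁ * A)
    (fun x hx => (hasDerivAt_sol hΨ hΨA t hx).congr_of_eventuallyEq <| by
      filter_upwards [Ioi_mem_nhds hx] with y hy using hut y hy)
    (fun x hx => (hasDerivAt_solDeriv hΨ hΨA t hx).continuousAt.continuousWithinAt)
    (fun x hx => weight_nonneg β hx)
    (fun x hx => by rw [hut x hx]; exact abs_sol_le_weight hT.le hΨA hΨ0 hβ ht.2 hx)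
    (fun x hx => abs_solDeriv_le_weight hT.le hΨ hΨA hΨ0 β.2 hβ hH ht.2 hx)
  refine hle.trans_eq ?_
  have hA0 : (0 : ℝ) ≤ A := A.2
  rw [ENNReal.ofReal_mul' hA0, ENNReal.ofReal_mul' hA0, ENNReal.ofReal_coe_nnreal, ← hA, ← hW]
  push_cast
  simp only [ENNReal.ofReal]
  ring
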